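/- Fix a positive integer $m$ and let $I_k$ be the set of words of length $k\ge 0$ over the alphabet $\{1,\dots,m\}$, $I=\bigcup_{k\ge0} I_k$, and $I_\infty$ the space of infinite words with the product topology. For $\mathbf i\in I_\infty$ write $\mathbf i|k\in I_k$ for its first $k$ letters, and for $\mathbf i\in I_k$ write $|\mathbf i|=k$ and let $C_{\mathbf i}=\{\mathbf j\in I_\infty:\mathbf j|k=\mathbf i\}$ be its cylinder. Let $\{W_{\mathbf i}:\mathbf i\in I\}$ be independent, almost surely strictly positive real random variables on a probability space, not necessarily identically distributed, with $\mathbb E(W_{\mathbf i})=1$ for every $\mathbf i$. Put $$X_{i_1,\dots,i_k}=W_{i_1}W_{i_1,i_2}\cdots W_{i_1,\dots,i_k},\qquad X_\emptyset=1,\qquad \mathcal F_k=\sigma(W_{\mathbf i}:|\mathbf i|\le k).$$ Let $\mu$ be a Borel probability measure on $I_\infty$ and let $q>1$ be real. For $k\ge0$ let $$M_k=\int_{I_\infty}X_{\mathbf i|k}\,d\mu(\mathbf i).$$ Suppose that $$\limsup_{k\to\infty}\Big(\sum_{|\mathbf i|=k}\mathbb E\big((X_{\mathbf i}\,\mu(C_{\mathbf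 i}))^q\big)\Big)^{1/k}<1,$$ where expectations of nonnegative random variables take values in $[0,\infty]$. Then $M_k=\sum_{|\mathbf i|=k}X_{\mathbf i}\,\mu(C_{\mathbf i})$ for every $k$, $(M_k)$ is a martingale with respect to $(\mathcal F_k)$, and $$\limsup_{k\to\infty}\mathbb E\Big(\Big(\int_{I_\infty} X_{\mathbf i|k}\,d\mu(\mathbf i)\Big)^q\Big)=\limsup_{k\to\infty}\mathbb E\Big(\Big(\sum_{|\mathbf i|=k}X_{\mathbf i}\,\mu(C_{\mathbf i})\Big)^q\Big)<\infty,$$ and $\sup_{k}\mathbb E(M_k^q)<\infty$. Moreover there is a random variable $Z\in L^q$ such that $M_k\to Z$ almost surely and in $L^q$ as $k\to\infty$. -/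

import Mathlib

open MeasureTheory ProbabilityTheory Filter Topology

noncomputable section

namespace Cascade

/-- Finite words over the alphabet `Fin m`: pairs of a length `k` and a word of length `k`.
The words of length `k` are the functions `Fin k → Fin m`, and the infinite words are the sequences
`ℕ → Fin m`, whose product topology is that of the metric `m ^ (-|i ∧ j|)`
and whose product σ-algebra is the Borel σ-algebra. -/
abbrev Word (m : ℕ) : Type := Σ k : ℕ, (Fin k → Fin m)

/-- The curtailment after `j` letters of a word of length `k ≥ j`. -/
def curtailWord {m k : ℕ} (i : Fin k → Fin m) (j : ℕ) (hj : j ≤ k) : Fin j → Fin m :=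
  fun r => i (Fin.castLE hj r)

/-- The curtailment `i|k` of an infinite word. -/
def curtail {m : ℕ} (i : ℕ → Fin m) (k : ℕ) : Fin k → Fin m :=
  fun r => i r

/-- The cylinder of all infinite words that begin with `i`. -/
def cylinder {m k : ℕ} (i : Fin k → Fin m) : Set (ℕ → Fin m) :=
  {j | curtail j k = i}

/-- `X_{i₁,…,i_k} = W_{i₁} W_{i₁,i₂} ⋯ W_{i₁,…,i_k}`; the weight of the empty word does not occur. -/
def X {m : ℕ} {Ω : Type*} (W : Word m → Ω → ℝ) {k : ℕ} (i : Fin k → Fin m) (ω : Ω) : ℝ :=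
  ∏ r : Fin k, W ⟨r + 1, curtailWord i (r + 1) r.isLt⟩ ω

/-- The total mass `∫ X_{i|k} dμ(i)` of the random measure of level `k`. -/
def totalMass {m : ℕ} {Ω : Type*} (W : Word m → Ω → ℝ) (μ : Measure (ℕ → Fin m))
    (k : ℕ) (ω : Ω) : ℝ :=
  ∫ i, X W (curtail i k) ω ∂μ

/-- The sum `∑_{|i| = k} X_i μ(C_i)`. -/
def cylinderSum {m : ℕ} {Ω : Type*} (W : Word m → Ω → ℝ) (μ : Measure (ℕ → Fin m))
    (k : ℕ) (ω : Ω) : ℝ :=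
  ∑ i : Fin k → Fin m, X W i ω * μ.real (cylinder i)

/-- The expectation `E(Z ^ q)` of an almost surely nonnegative random variable,
with values in `[0, ∞]`. -/
def moment {Ω : Type*} [MeasurableSpace Ω] (P : Measure Ω) (q : ℝ) (Z : Ω → ℝ) : ENNReal :=
  ∫⁻ ω, ENNReal.ofReal (Z ω ^ q) ∂P

/-- The σ-algebras `F_k = σ(W_i : |i| ≤ k)`. -/
def filtration {m : ℕ} {Ω : Type*} [mΩ : MeasurableSpace Ω] (W : Word m → Ω → ℝ)
    (hW : ∀ i, Measurable (W i)) : Filtration ℕ mΩ where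
  seq k := ⨆ (i : Word m) (_ : i.1 ≤ k), MeasurableSpace.comap (W i) inferInstance
  mono' _ _ hkl := iSup_mono fun _ => iSup_mono' fun hi => ⟨hi.trans hkl, le_rfl⟩
  le' _ := iSup_le fun i => iSup_le fun _ => (hW i).comap_le

end Cascade

end

/-
Given the weights up to level `k`, the masses which the cascade gives to the children of a word `u`
of length `k` are independent. A Rosenthal-type inequality therefore bounds the `q`-th moment of
their sum by `D` times the sum of their `q`-th moments plus a multiple of the `q`-th power of their
total mean, which is `X_u μ(C_u)`; here `D > 1` is as close to `1` as we like. Iterated down the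
tree, this bounds the moments of the total mass by a series `∑ i, D ^ i * A (K + i)`, where `A k` is
the moment sum of the hypothesis, and the series converges by the root test if `D` is small enough.
The total mass is thus a martingale bounded in `L^q`, and it converges.
-/

open scoped NNReal ENNReal

section LpMartingale

variable {Ω E ι : Type*} {mΩ : MeasurableSpace Ω} {P : Measure Ω} [NormedAddCommGroup E]

lemma unifIntegrable_of_eLpNorm_le {r p : ℝ≥0∞} (hr : r ≠ 0) (hrp : r < p) {f : ι → Ω → E}
    (hf : ∀ i, AEStronglyMeasurable (f i) P) {R : ℝ≥0} (hR : ∀ i, eLpNorm (f i) p P ≤ R) :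
    UnifIntegrable f r P := by
  intro ε hε
  obtain ⟨e, he⟩ : ∃ e : ℝ, e = 1 / r.toReal - 1 / p.toReal := ⟨_, rfl⟩
  have he0 : 0 < e := by
    rw [he, sub_pos]
    rcases eq_or_ne p ∞ with rfl | hp
    · simpa using ENNReal.toReal_pos hr hrp.ne
    · exact one_div_lt_one_div_of_lt (ENNReal.toReal_pos hr hrp.ne_top)
        (ENNReal.toReal_strict_mono hp hrp)
  refine ⟨(ε / (R + 1)) ^ (1 / e), by positivity, fun i s hs hPs => ?_⟩
  have hPs' : P s ^ e ≤ ENNReal.ofReal (ε / (R + 1)) := by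
    calc P s ^ e ≤ ENNReal.ofReal ((ε / (R + 1)) ^ (1 / e)) ^ e := by gcongr
      _ = ENNReal.ofReal (ε / (R + 1)) := by
        rw [ENNReal.ofReal_rpow_of_nonneg (by positivity) he0.le,
          ← Real.rpow_mul (by positivity), one_div_mul_cancel he0.ne', Real.rpow_one]
  calc eLpNorm (s.indicator (f i)) r P
      = eLpNorm (f i) r (P.restrict s) := eLpNorm_indicator_eq_eLpNorm_restrict hs
    _ ≤ eLpNorm (f i) p (P.restrict s) * P s ^ e := by
        rw [he, ← Measure.restrict_apply_univ s]
        exact eLpNorm_le_eLpNorm_mul_rpow_measure_univ hrp.le (hf i).restrict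
    _ ≤ R * ENNReal.ofReal (ε / (R + 1)) := by
        gcongr
        exact (eLpNorm_mono_measure _ Measure.restrict_le_self).trans (hR i)
    _ ≤ ENNReal.ofReal ε := by
        rw [← ENNReal.ofReal_coe_nnreal, ← ENNReal.ofReal_mul R.coe_nonneg]
        apply ENNReal.ofReal_le_ofReal
        rw [mul_div_assoc', div_le_iff₀ (by positivity)]
        nlinarith [R.coe_nonneg]

lemma unifIntegrable_condExp [NormedSpace ℝ E] [CompleteSpace E] [IsFiniteMeasure P]
    {p : ℝ≥0∞} (hp : 1 ≤ p) (hp' : p ≠ ∞) {Z : Ω → E} (hZ : MemLp Z p P)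
    {ℱ : ι → MeasurableSpace Ω} (hℱ : ∀ i, ℱ i ≤ mΩ) :
    UnifIntegrable (fun i => P[Z | ℱ i]) p P := by
  intro ε hε
  have hp0 : p ≠ 0 := (zero_lt_one.trans_le hp).ne'
  have hr : 1 ≤ p.toReal := by
    simpa using ENNReal.toReal_mono hp' hp
  have hr0 : 0 < p.toReal := by linarith
  have hint : Integrable (fun ω => ‖Z ω‖ ^ p.toReal) P := hZ.integrable_norm_rpow hp0 hp'
  obtain ⟨δ, hδ, h⟩ := (hint.uniformIntegrable_condExp hℱ).2.1 (ε := ε ^ p.toReal) (by positivity)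
  refine ⟨δ, hδ, fun i s hs hPs => ?_⟩
  have hJensen : eLpNorm (s.indicator P[Z | ℱ i]) p P ^ p.toReal ≤
      eLpNorm (s.indicator P[fun ω => ‖Z ω‖ ^ p.toReal | ℱ i]) 1 P := by
    rw [← ENNReal.ofReal_toReal hp', ENNReal.toReal_ofReal hr0.le,
      ← one_mul (ENNReal.ofReal p.toReal), ← eLpNorm_norm_rpow _ hr0]
    refine eLpNorm_mono_ae ?_
    filter_upwards [Integrable.norm_condExp_rpow_le (m := ℱ i) hr hint] with ω hω
    by_cases hωs : ω ∈ s
    · simpa [hωs, abs_of_nonneg, Real.rpow_nonneg] using hω.trans (le_abs_self _)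
    · simp [hωs, hr0.ne']
  rw [← ENNReal.rpow_le_rpow_iff hr0, ENNReal.ofReal_rpow_of_pos hε]
  exact hJensen.trans (h i s hs hPs)

lemma exists_tendsto_Lp_of_martingale [IsFiniteMeasure P] {p : ℝ≥0∞} (hp : 1 < p) (hp' : p ≠ ∞)
    {ℱ : Filtration ℕ mΩ} {f : ℕ → Ω → ℝ} (hf : Martingale f ℱ P) {R : ℝ≥0}
    (hR : ∀ k, eLpNorm (f k) p P ≤ R) :
    ∃ Z : Ω → ℝ, MemLp Z p P ∧ (∀ᵐ ω ∂P, Tendsto (fun k => f k ω) atTop (𝓝 (Z ω))) ∧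
      Tendsto (fun k => eLpNorm (f k - Z) p P) atTop (𝓝 0) := by
  have hmeas : ∀ k, AEStronglyMeasurable (f k) P := fun k =>
    ((hf.1 k).mono (ℱ.le k)).aestronglyMeasurable
  obtain ⟨R', hR'⟩ : ∃ R' : ℝ≥0, ∀ k, eLpNorm (f k) 1 P ≤ R' := by
    have hfin : R * P Set.univ ^ (1 - 1 / p.toReal) ≠ ∞ := by
      have hpr : 1 ≤ p.toReal := by simpa using ENNReal.toReal_mono hp' hp.le
      exact ENNReal.mul_ne_top ENNReal.coe_ne_top (ENNReal.rpow_ne_top_of_nonneg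
        (sub_nonneg.2 ((div_le_one (by linarith)).2 hpr)) (measure_ne_top P _))
    lift R * P Set.univ ^ (1 - 1 / p.toReal) to ℝ≥0 using hfin with R' hR'
    refine ⟨R', fun k => hR'.symm ▸ ?_⟩
    calc eLpNorm (f k) 1 P ≤ eLpNorm (f k) p P * P Set.univ ^ (1 - 1 / p.toReal) := by
          simpa using eLpNorm_le_eLpNorm_mul_rpow_measure_univ hp.le (hmeas k)
      _ ≤ R * P Set.univ ^ (1 - 1 / p.toReal) := by gcongr; exact hR k
  have hUI : UniformIntegrable f 1 P :=
    ⟨hmeas, unifIntegrable_of_eLpNorm_le one_ne_zero hp hmeas hR, R', hR'⟩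
  obtain ⟨Z, hZ, hae, hcond⟩ : ∃ Z : Ω → ℝ, MemLp Z p P ∧
      (∀ᵐ ω ∂P, Tendsto (fun k => f k ω) atTop (𝓝 (Z ω))) ∧ ∀ k, f k =ᵐ[P] P[Z | ℱ k] :=
    ⟨_, hf.submartingale.memLp_limitProcess hR, hf.submartingale.ae_tendsto_limitProcess hR',
      hf.ae_eq_condExp_limitProcess hUI⟩
  have hUIp : UnifIntegrable f p P :=
    (unifIntegrable_congr_ae hcond).2 (unifIntegrable_condExp hp.le hp' hZ ℱ.le)
  exact ⟨Z, hZ, hae, tendsto_Lp_finite_of_tendsto_ae hp.le hp' hmeas hZ hUIp hae⟩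

lemma monotone_eLpNorm_of_martingale [Preorder ι] [NormedSpace ℝ E] [CompleteSpace E]
    {p : ℝ≥0∞} (hp : 1 ≤ p) {ℱ : Filtration ι mΩ} {f : ι → Ω → E} (hf : Martingale f ℱ P) :
    Monotone fun k => eLpNorm (f k) p P := fun i j hij => by
  dsimp only
  rw [← eLpNorm_congr_ae (hf.2 i j hij)]
  exact eLpNorm_condExp_le_eLpNorm _ hp

end LpMartingale

section MomentInequality

lemma rpow_sub_one_mul_self {q : ℝ} (hq : 1 ≤ q) (x : ℝ≥0∞) : x ^ (q - 1) * x = x ^ q := by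
  simpa using (ENNReal.rpow_add_of_nonneg (x := x) (q - 1) 1 (by linarith) zero_le_one).symm

lemma exists_add_rpow_le {p : ℝ} (hp : 0 < p) {D : ℝ≥0} (hD : 1 < D) :
    ∃ C : ℝ≥0, ∀ x y : ℝ≥0∞, (x + y) ^ p ≤ D * x ^ p + C * y ^ p := by
  obtain ⟨η, hη, hηD⟩ : ∃ η : ℝ≥0, 0 < η ∧ (1 + η) ^ p = D := by
    refine ⟨D ^ p⁻¹ - 1, tsub_pos_of_lt (NNReal.one_lt_rpow hD (by positivity)), ?_⟩
    rw [add_tsub_cancel_of_le (NNReal.one_le_rpow hD.le (by positivity)),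
      NNReal.rpow_inv_rpow hp.ne']
  refine ⟨(η⁻¹ + 1) ^ p, fun x y => ?_⟩
  rw [← hηD, ENNReal.coe_rpow_of_nonneg _ hp.le, ENNReal.coe_rpow_of_nonneg _ hp.le,
    ← ENNReal.mul_rpow_of_nonneg _ _ hp.le, ← ENNReal.mul_rpow_of_nonneg _ _ hp.le]
  rw [ENNReal.coe_add, ENNReal.coe_add, ENNReal.coe_one, ENNReal.coe_inv hη.ne']
  rcases le_total y (η * x) with h | h
  · refine le_add_right (ENNReal.rpow_le_rpow ?_ hp.le)
    rw [add_mul, one_mul]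
    gcongr
  · refine le_add_left (ENNReal.rpow_le_rpow ?_ hp.le)
    rw [add_mul, one_mul]
    gcongr
    exact (ENNReal.mul_le_iff_le_inv (by simpa using hη.ne') ENNReal.coe_ne_top).1 h

lemma exists_rpow_sub_one_mul_le {q : ℝ} (hq : 1 ≤ q) {δ : ℝ≥0} (hδ : 0 < δ) :
    ∃ C : ℝ≥0, ∀ x t : ℝ≥0∞, x ^ (q - 1) * t ≤ δ * x ^ q + C * t ^ q := by
  have hq' : 0 ≤ q - 1 := by linarith
  refine ⟨δ⁻¹ ^ (q - 1), fun x t => ?_⟩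
  rcases le_total t (δ * x) with h | h
  · refine le_add_right ?_
    calc x ^ (q - 1) * t ≤ x ^ (q - 1) * (δ * x) := by gcongr
      _ = δ * x ^ q := by rw [mul_left_comm, rpow_sub_one_mul_self hq]
  · refine le_add_left ?_
    calc x ^ (q - 1) * t ≤ ((δ⁻¹ : ℝ≥0) * t) ^ (q - 1) * t := by
          gcongr
          rw [ENNReal.coe_inv hδ.ne']
          exact (ENNReal.mul_le_iff_le_inv (by simpa using hδ.ne') ENNReal.coe_ne_top).1 h
      _ = (δ⁻¹ ^ (q - 1) : ℝ≥0) * t ^ q := by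
        rw [ENNReal.mul_rpow_of_nonneg _ _ hq', mul_assoc, rpow_sub_one_mul_self hq,
          ENNReal.coe_rpow_of_nonneg _ hq']

variable {ι : Type*} [Fintype ι]

lemma exists_sum_rpow_le [DecidableEq ι] {q : ℝ} (hq : 1 < q) {D : ℝ≥0} (hD : 1 < D) :
    ∃ C : ℝ≥0, ∀ x : ι → ℝ≥0∞, (∑ i, x i) ^ q ≤
      D * ∑ i, x i ^ q + C * ∑ i, x i * (∑ j ∈ {i}ᶜ, x j) ^ (q - 1) := by
  obtain ⟨C, hC⟩ := exists_add_rpow_le (sub_pos.2 hq) hD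
  refine ⟨C, fun x => ?_⟩
  calc (∑ i, x i) ^ q = ∑ i, x i * (∑ j, x j) ^ (q - 1) := by
        rw [← Finset.sum_mul, mul_comm, rpow_sub_one_mul_self hq.le]
    _ ≤ ∑ i, x i * (D * x i ^ (q - 1) + C * (∑ j ∈ {i}ᶜ, x j) ^ (q - 1)) := by
        gcongr with i
        rw [Fintype.sum_eq_add_sum_compl i]
        exact hC _ _
    _ = D * ∑ i, x i ^ q + C * ∑ i, x i * (∑ j ∈ {i}ᶜ, x j) ^ (q - 1) := by
        rw [Finset.mul_sum, Finset.mul_sum, ← Finset.sum_add_distrib]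
        refine Finset.sum_congr rfl fun i _ => ?_
        rw [← rpow_sub_one_mul_self hq.le]
        ring

variable {Ω : Type*} [MeasurableSpace Ω] (P : Measure Ω)

lemma lintegral_sum_rpow_le {q : ℝ} (hq : 1 ≤ q) {x : ι → Ω → ℝ≥0∞} (hx : ∀ i, Measurable (x i)) :
    ∫⁻ ω, (∑ i, x i ω) ^ q ∂P ≤
      (Fintype.card ι : ℝ≥0∞) ^ (q - 1) * ∑ i, ∫⁻ ω, x i ω ^ q ∂P := by
  calc ∫⁻ ω, (∑ i, x i ω) ^ q ∂P
      ≤ ∫⁻ ω, (Fintype.card ι : ℝ≥0∞) ^ (q - 1) * ∑ i, x i ω ^ q ∂P :=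
        lintegral_mono fun ω => by
          simpa using ENNReal.rpow_sum_le_const_mul_sum_rpow Finset.univ (fun i => x i ω) hq
    _ = _ := by
        rw [lintegral_const_mul _ (Finset.measurable_sum _ fun i _ => (hx i).pow_const q),
          lintegral_finsetSum _ fun i _ => (hx i).pow_const q]

lemma exists_lintegral_rpow_sub_one_mul_le [IsProbabilityMeasure P] {q : ℝ} (hq : 1 ≤ q)
    {δ : ℝ≥0} (hδ : 0 < δ) :
    ∃ C : ℝ≥0, ∀ f : Ω → ℝ≥0∞, Measurable f → ∀ t : ℝ≥0∞,
      (∫⁻ ω, f ω ^ (q - 1) ∂P) * t ≤ δ * ∫⁻ ω, f ω ^ q ∂P + C * t ^ q := by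
  obtain ⟨C, hC⟩ := exists_rpow_sub_one_mul_le hq hδ
  refine ⟨C, fun f hf t => ?_⟩
  calc (∫⁻ ω, f ω ^ (q - 1) ∂P) * t
      = ∫⁻ ω, f ω ^ (q - 1) * t ∂P := (lintegral_mul_const _ (hf.pow_const _)).symm
    _ ≤ ∫⁻ ω, (δ * f ω ^ q + C * t ^ q) ∂P := lintegral_mono fun ω => hC _ _
    _ = δ * ∫⁻ ω, f ω ^ q ∂P + C * t ^ q := by
        rw [lintegral_add_right _ measurable_const, lintegral_const,
          lintegral_const_mul _ (hf.pow_const _), measure_univ, mul_one]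

lemma sum_lintegral_mul_rpow_sub_one_le [DecidableEq ι] {q : ℝ} (hq : 1 ≤ q)
    {x : ι → Ω → ℝ≥0∞} (hx : ∀ i, Measurable (x i))
    (hind : ∀ i, IndepFun (x i) (fun ω => ∑ j ∈ {i}ᶜ, x j ω) P) :
    ∑ i, ∫⁻ ω, x i ω * (∑ j ∈ {i}ᶜ, x j ω) ^ (q - 1) ∂P ≤
      (∫⁻ ω, (∑ i, x i ω) ^ (q - 1) ∂P) * ∫⁻ ω, ∑ i, x i ω ∂P := by
  rw [lintegral_finsetSum _ fun i _ => hx i, Finset.mul_sum]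
  refine Finset.sum_le_sum fun i _ => ?_
  have hind' : IndepFun (x i) (fun ω => (∑ j ∈ {i}ᶜ, x j ω) ^ (q - 1)) P :=
    (hind i).comp (φ := id) (ψ := fun y : ℝ≥0∞ => y ^ (q - 1)) measurable_id (by fun_prop)
  rw [lintegral_mul_eq_lintegral_mul_lintegral_of_indepFun'' (hx i).aemeasurable (by fun_prop)
    hind', mul_comm]
  gcongr with ω
  exact Finset.subset_univ _

/- A Rosenthal-type inequality; what matters is that `D` can be taken arbitrarily close to `1`. -/
lemma exists_lintegral_sum_rpow_le [IsProbabilityMeasure P] [DecidableEq ι] {q : ℝ} (hq : 1 < q)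
    {D : ℝ≥0} (hD : 1 < D) :
    ∃ C : ℝ≥0, ∀ x : ι → Ω → ℝ≥0∞, (∀ i, Measurable (x i)) →
      (∀ i, IndepFun (x i) (fun ω => ∑ j ∈ {i}ᶜ, x j ω) P) →
      ∫⁻ ω, (∑ i, x i ω) ^ q ∂P ≤
        D * ∑ i, ∫⁻ ω, x i ω ^ q ∂P + C * (∫⁻ ω, ∑ i, x i ω ∂P) ^ q := by
  obtain ⟨D₀, hD₀, hD₀D⟩ := exists_between hD
  obtain ⟨C₀, hC₀⟩ := exists_sum_rpow_le (ι := ι) hq hD₀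
  obtain ⟨δ, hδ, hδD⟩ : ∃ δ : ℝ≥0, 0 < δ ∧
      D₀ + C₀ * δ * (Fintype.card ι : ℝ≥0) ^ (q - 1) ≤ D := by
    obtain ⟨δ, hδ, h⟩ := exists_pos_mul_lt (tsub_pos_of_lt hD₀D)
      (C₀ * (Fintype.card ι : ℝ≥0) ^ (q - 1))
    exact ⟨δ, hδ, by simpa [mul_right_comm] using (lt_tsub_iff_left.1 h).le⟩
  obtain ⟨C₁, hC₁⟩ := exists_lintegral_rpow_sub_one_mul_le P hq.le hδ
  refine ⟨C₀ * C₁, fun x hx hind => ?_⟩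
  calc ∫⁻ ω, (∑ i, x i ω) ^ q ∂P
      ≤ ∫⁻ ω, (D₀ * ∑ i, x i ω ^ q + C₀ * ∑ i, x i ω * (∑ j ∈ {i}ᶜ, x j ω) ^ (q - 1)) ∂P :=
        lintegral_mono fun ω => hC₀ _
    _ = D₀ * ∑ i, ∫⁻ ω, x i ω ^ q ∂P +
          C₀ * ∑ i, ∫⁻ ω, x i ω * (∑ j ∈ {i}ᶜ, x j ω) ^ (q - 1) ∂P := by
        rw [lintegral_add_left (by fun_prop), lintegral_const_mul _ (by fun_prop),
          lintegral_const_mul _ (by fun_prop), lintegral_finsetSum _ (by fun_prop),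
          lintegral_finsetSum _ (by fun_prop)]
    _ ≤ D₀ * ∑ i, ∫⁻ ω, x i ω ^ q ∂P + C₀ * (δ * ((Fintype.card ι : ℝ≥0∞) ^ (q - 1) *
          ∑ i, ∫⁻ ω, x i ω ^ q ∂P) + C₁ * (∫⁻ ω, ∑ i, x i ω ∂P) ^ q) := by
        gcongr
        refine (sum_lintegral_mul_rpow_sub_one_le P hq.le hx hind).trans
          ((hC₁ _ (by fun_prop) _).trans ?_)
        gcongr
        exact lintegral_sum_rpow_le P hq.le hx
    _ = ((D₀ + C₀ * δ * (Fintype.card ι : ℝ≥0) ^ (q - 1) : ℝ≥0) : ℝ≥0∞) *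
          ∑ i, ∫⁻ ω, x i ω ^ q ∂P + ((C₀ * C₁ : ℝ≥0) : ℝ≥0∞) * (∫⁻ ω, ∑ i, x i ω ∂P) ^ q := by
        push_cast [ENNReal.coe_rpow_of_nonneg _ (sub_nonneg.2 hq.le)]
        ring
    _ ≤ _ := by gcongr

end MomentInequality

lemma exists_tsum_pow_mul_ne_top_of_limsup_lt {A : ℕ → ℝ≥0∞}
    (hA : limsup (fun k : ℕ => A k ^ (1 / (k : ℝ))) atTop < 1) :
    ∃ D : ℝ≥0, 1 < D ∧ ∃ K, ∑' i, (D : ℝ≥0∞) ^ i * A (K + i) ≠ ∞ := by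
  obtain ⟨r, hAr, hr⟩ := exists_between hA
  lift r to ℝ≥0 using (hr.trans ENNReal.one_lt_top).ne
  have hr0 : 0 < r := by exact_mod_cast zero_le.trans_lt hAr
  obtain ⟨D, hD, hDr⟩ := exists_between ((one_lt_inv₀ hr0).2 (by exact_mod_cast hr))
  have hDr1 : D * r < 1 := (lt_mul_inv_iff₀ hr0).1 (by rwa [one_mul])
  have hle : ∀ᶠ k : ℕ in atTop, A k ≤ (r : ℝ≥0∞) ^ k := by
    filter_upwards [eventually_lt_of_limsup_lt hAr, eventually_gt_atTop 0] with k hk hk0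
    rw [one_div] at hk
    exact (ENNReal.rpow_inv_le_iff (by exact_mod_cast hk0)).1 hk.le |>.trans_eq
      (ENNReal.rpow_natCast _ _)
  obtain ⟨K, hK⟩ := eventually_atTop.1 hle
  have hgeom : ∑' i, ((D * r : ℝ≥0) : ℝ≥0∞) ^ i ≠ ∞ := by
    rw [ENNReal.tsum_geometric]
    refine ENNReal.inv_ne_top.2 (tsub_pos_of_lt ?_).ne'
    exact_mod_cast hDr1
  refine ⟨D, hD, K, ne_top_of_le_ne_top (ENNReal.mul_ne_top (by simp) hgeom)
    (b := (r : ℝ≥0∞) ^ K * ∑' i, ((D * r : ℝ≥0) : ℝ≥0∞) ^ i) ?_⟩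
  rw [← ENNReal.tsum_mul_left]
  refine ENNReal.tsum_le_tsum fun i => ?_
  calc (D : ℝ≥0∞) ^ i * A (K + i) ≤ (D : ℝ≥0∞) ^ i * (r : ℝ≥0∞) ^ (K + i) := by
        gcongr
        exact hK _ (K.le_add_right i)
    _ = (r : ℝ≥0∞) ^ K * ((D * r : ℝ≥0) : ℝ≥0∞) ^ i := by
        push_cast
        ring

section SigmaAlgebras

variable {ι Ω β : Type*} [MeasurableSpace β] {V : ι → Ω → β} {S T : Set ι}

/-- The σ-algebra `σ(V_i : i ∈ S)`. -/
abbrev sigmaOn (V : ι → Ω → β) (S : Set ι) : MeasurableSpace Ω :=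
  ⨆ i ∈ S, MeasurableSpace.comap (V i) inferInstance

lemma measurable_sigmaOn {i : ι} (hi : i ∈ S) : Measurable[sigmaOn V S] (V i) :=
  (comap_measurable (V i)).mono
    (le_biSup (fun j => MeasurableSpace.comap (V j) inferInstance) hi) le_rfl

lemma sigmaOn_mono (hST : S ⊆ T) : sigmaOn V S ≤ sigmaOn V T :=
  biSup_mono hST

variable [mΩ : MeasurableSpace Ω] {P : Measure Ω}

lemma sigmaOn_le (hV : ∀ i, Measurable (V i)) (S : Set ι) : sigmaOn V S ≤ mΩ :=
  iSup₂_le fun i _ => (hV i).comap_le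

lemma indep_sigmaOn (hV : ∀ i, Measurable (V i)) (hind : iIndepFun V P) (hST : Disjoint S T) :
    Indep (sigmaOn V S) (sigmaOn V T) P :=
  indep_iSup_of_disjoint (fun i => (hV i).comap_le) hind hST

lemma indepFun_of_measurable_sigmaOn (hV : ∀ i, Measurable (V i)) (hind : iIndepFun V P)
    (hST : Disjoint S T) {α γ : Type*} [MeasurableSpace α] [MeasurableSpace γ] {f : Ω → α}
    {g : Ω → γ} (hf : Measurable[sigmaOn V S] f) (hg : Measurable[sigmaOn V T] g) :
    IndepFun f g P :=
  indep_of_indep_of_le_right (indep_of_indep_of_le_left (indep_sigmaOn hV hind hST) hf.comap_le)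
    hg.comap_le

end SigmaAlgebras

namespace Cascade

section Words

variable {m k : ℕ}

/-- The word `u` followed by the letter `a`. -/
def append (u : Fin k → Fin m) (a : Fin m) : Fin (k + 1) → Fin m :=
  Fin.snoc (α := fun _ => Fin m) u a

lemma curtailWord_append {j : ℕ} (u : Fin k → Fin m) (a : Fin m) (hj : j ≤ k) :
    curtailWord (append u a) j (hj.trans k.le_succ) = curtailWord u j hj :=
  funext fun r => Fin.snoc_castSucc (α := fun _ => Fin m) a u (Fin.castLE hj r)

lemma append_injective (u : Fin k → Fin m) : Function.Injective (append u) := fun a b h => by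
  simpa [append] using congrFun h (Fin.last k)

lemma exists_eq_append (v : Fin (k + 1) → Fin m) : ∃ u a, v = append u a :=
  ⟨Fin.init v, v (Fin.last k), (Fin.snoc_init_self (α := fun _ => Fin m) v).symm⟩

lemma sum_append {M : Type*} [AddCommMonoid M] (f : (Fin (k + 1) → Fin m) → M) :
    ∑ v, f v = ∑ u : Fin k → Fin m, ∑ a, f (append u a) := by
  rw [← (Fin.snocEquiv fun _ : Fin (k + 1) => Fin m).sum_comp, Fintype.sum_prod_type,
    Finset.sum_comm]
  rfl

/-- The product `v_{i₁} v_{i₁,i₂} ⋯ v_{i₁,…,i_k}` along the nonempty prefixes of a word, so that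
`X W u ω` is the path product of the values `W w ω`. -/
def pathProd {M : Type*} [CommMonoid M] (v : Word m → M) (u : Fin k → Fin m) : M :=
  ∏ r : Fin k, v ⟨r + 1, curtailWord u (r + 1) r.isLt⟩

lemma pathProd_append {M : Type*} [CommMonoid M] (v : Word m → M) (u : Fin k → Fin m)
    (a : Fin m) : pathProd v (append u a) = pathProd v u * v ⟨k + 1, append u a⟩ := by
  rw [pathProd, Fin.prod_univ_castSucc]
  congr 1
  exact Finset.prod_congr rfl fun r _ =>
    congrArg (fun w => v ⟨r + 1, w⟩) (curtailWord_append u a r.isLt)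

/-- The words that begin with `u`. -/
def extensions (u : Fin k → Fin m) : Set (Word m) :=
  {w | ∃ h : k ≤ w.1, curtailWord w.2 k h = u}

/-- The words longer than `u` that begin with `u`. -/
def properExtensions (u : Fin k → Fin m) : Set (Word m) :=
  {w | ∃ h : k < w.1, curtailWord w.2 k h.le = u}

lemma mem_extensions_self (u : Fin k → Fin m) : (⟨k, u⟩ : Word m) ∈ extensions u :=
  ⟨le_rfl, rfl⟩

lemma properExtensions_subset_extensions (u : Fin k → Fin m) :
    properExtensions u ⊆ extensions u := fun _ ⟨h, hw⟩ => ⟨h.le, hw⟩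

lemma extensions_append_subset (u : Fin k → Fin m) (a : Fin m) :
    extensions (append u a) ⊆ properExtensions u := by
  rintro w ⟨h, hw⟩
  refine ⟨h, ?_⟩
  calc curtailWord w.2 k (k.le_succ.trans h) = curtailWord (append u a) k k.le_succ := by
        rw [← hw]; rfl
    _ = u := curtailWord_append u a le_rfl

lemma disjoint_length_le_properExtensions (u : Fin k → Fin m) :
    Disjoint {w : Word m | w.1 ≤ k} (properExtensions u) := by
  rw [Set.disjoint_left]
  rintro w hw ⟨h, -⟩
  exact h.not_ge hw

lemma disjoint_extensions {u v : Fin k → Fin m} (huv : u ≠ v) :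
    Disjoint (extensions u) (extensions v) := by
  rw [Set.disjoint_left]
  rintro w ⟨_, hw⟩ ⟨_, hw'⟩
  exact huv (hw.symm.trans hw')

end Words

section Cylinders

variable {m k : ℕ}

lemma measurable_curtail (k : ℕ) : Measurable fun i : ℕ → Fin m => curtail i k :=
  measurable_pi_lambda _ fun r => measurable_pi_apply (r : ℕ)

lemma curtail_succ (j : ℕ → Fin m) (k : ℕ) : curtail j (k + 1) = append (curtail j k) (j k) :=
  (Fin.snoc_init_self (α := fun _ => Fin m) (curtail j (k + 1))).symm

lemma cylinder_append (u : Fin k → Fin m) (a : Fin m) :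
    cylinder (append u a) = cylinder u ∩ {j | j k = a} := by
  ext j
  simp [cylinder, curtail_succ, append, Fin.snoc_inj]

lemma measure_cylinder_eq_sum (μ : Measure (ℕ → Fin m)) (u : Fin k → Fin m) :
    μ (cylinder u) = ∑ a, μ (cylinder (append u a)) := by
  have hletter : ∀ a ∈ Finset.univ, MeasurableSet ((fun j : ℕ → Fin m => j k) ⁻¹' {a}) :=
    fun a _ => measurable_pi_apply k (measurableSet_singleton a)
  have h := sum_measure_preimage_singleton (μ := μ.restrict (cylinder u)) Finset.univ hletter
  simp only [Finset.coe_univ, Set.preimage_univ, Measure.restrict_apply_univ] at h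
  rw [← h]
  refine Finset.sum_congr rfl fun a _ => ?_
  rw [Measure.restrict_apply (hletter a (Finset.mem_univ a)), cylinder_append, Set.inter_comm]
  rfl

lemma measureReal_cylinder_eq_sum (μ : Measure (ℕ → Fin m)) [IsFiniteMeasure μ]
    (u : Fin k → Fin m) : μ.real (cylinder u) = ∑ a, μ.real (cylinder (append u a)) := by
  simp_rw [measureReal_def]
  rw [measure_cylinder_eq_sum, ENNReal.toReal_sum fun a _ => measure_ne_top _ _]

lemma integral_curtail (μ : Measure (ℕ → Fin m)) [IsFiniteMeasure μ] {E : Type*}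
    [NormedAddCommGroup E] [NormedSpace ℝ E] [CompleteSpace E] (f : (Fin k → Fin m) → E) :
    ∫ i, f (curtail i k) ∂μ = ∑ u, μ.real (cylinder u) • f u := by
  have hf : AEStronglyMeasurable f (μ.map fun i => curtail i k) := .of_discrete
  rw [← integral_map (measurable_curtail k).aemeasurable hf, integral_fintype .of_finite]
  simp_rw [map_measureReal_apply (measurable_curtail k) (measurableSet_singleton _)]
  rfl

end Cylinders

section MomentBound

variable {m k : ℕ} {Ω : Type*}

lemma measurable_pathProd {M : Type*} [CommMonoid M] [MeasurableSpace M] [MeasurableMul₂ M]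
    (V : Word m → Ω → M) (u : Fin k → Fin m) :
    Measurable[sigmaOn V {w | w.1 ≤ k}] fun ω => pathProd (fun w => V w ω) u :=
  Finset.measurable_prod _ fun r _ => measurable_sigmaOn (S := {w : Word m | w.1 ≤ k}) r.isLt

/-- The mass `∑_{|v| = l} V_{u v₁} ⋯ V_{u v₁ ⋯ v_l} μ(C_{uv})` which the cascade gives to the
cylinder of `u` after `l` further levels, the weights of the prefixes of `u` being left out. -/
noncomputable def tailMass (V : Word m → Ω → ℝ≥0∞) (μ : Measure (ℕ → Fin m)) :
    ℕ → ∀ {k : ℕ}, (Fin k → Fin m) → Ω → ℝ≥0∞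
  | 0, _, u, _ => μ (cylinder u)
  | l + 1, k, u, ω => ∑ a, V ⟨k + 1, append u a⟩ ω * tailMass V μ l (append u a) ω

/-- The total mass `∑_{|v| = n} V_{v₁} ⋯ V_{v₁ ⋯ v_n} μ(C_v)` of the cascade of level `n`, the
counterpart of `cylinderSum` for weights with values in `[0, ∞]`. -/
noncomputable def levelMass (V : Word m → Ω → ℝ≥0∞) (μ : Measure (ℕ → Fin m)) (n : ℕ)
    (ω : Ω) : ℝ≥0∞ :=
  ∑ v : Fin n → Fin m, pathProd (fun w => V w ω) v * μ (cylinder v)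

lemma sum_pathProd_mul_tailMass (V : Word m → Ω → ℝ≥0∞) (μ : Measure (ℕ → Fin m)) (k l : ℕ)
    (ω : Ω) : ∑ u : Fin k → Fin m, pathProd (fun w => V w ω) u * tailMass V μ l u ω =
      levelMass V μ (k + l) ω := by
  induction l generalizing k with
  | zero => rfl
  | succ l ih =>
    rw [← add_assoc, add_right_comm, ← ih (k + 1), sum_append]
    refine Finset.sum_congr rfl fun u _ => ?_
    simp_rw [tailMass, Finset.mul_sum, pathProd_append, mul_assoc]

lemma measurable_tailMass (V : Word m → Ω → ℝ≥0∞) (μ : Measure (ℕ → Fin m)) (l : ℕ)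
    (u : Fin k → Fin m) : Measurable[sigmaOn V (properExtensions u)] (tailMass V μ l u) := by
  induction l generalizing k with
  | zero => exact measurable_const
  | succ l ih =>
    refine Finset.measurable_sum _ fun a _ => (measurable_sigmaOn ?_).mul ((ih _).mono ?_ le_rfl)
    · exact extensions_append_subset u a (mem_extensions_self _)
    · exact sigmaOn_mono ((properExtensions_subset_extensions _).trans
        (extensions_append_subset u a))

lemma measurable_mul_tailMass (V : Word m → Ω → ℝ≥0∞) (μ : Measure (ℕ → Fin m)) (l : ℕ)
    (u : Fin k → Fin m) :
    Measurable[sigmaOn V (extensions u)] fun ω => V ⟨k, u⟩ ω * tailMass V μ l u ω :=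
  (measurable_sigmaOn (mem_extensions_self u)).mul
    ((measurable_tailMass V μ l u).mono (sigmaOn_mono (properExtensions_subset_extensions u))
      le_rfl)

variable [MeasurableSpace Ω] {P : Measure Ω} {V : Word m → Ω → ℝ≥0∞}

lemma lintegral_tailMass [IsProbabilityMeasure P] (hV : ∀ w, Measurable (V w))
    (hind : iIndepFun V P) (hmean : ∀ w, ∫⁻ ω, V w ω ∂P = 1) (μ : Measure (ℕ → Fin m)) (l : ℕ)
    (u : Fin k → Fin m) : ∫⁻ ω, tailMass V μ l u ω ∂P = μ (cylinder u) := by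
  induction l generalizing k with
  | zero => simp [tailMass]
  | succ l ih =>
    have hT : ∀ a, Measurable (tailMass V μ l (append u a)) := fun a =>
      (measurable_tailMass V μ l _).mono (sigmaOn_le hV _) le_rfl
    have hVT : ∀ a, Measurable fun ω => V ⟨k + 1, append u a⟩ ω * tailMass V μ l (append u a) ω :=
      fun a => (hV _).mul (hT a)
    simp_rw [tailMass]
    rw [lintegral_finsetSum _ fun a _ => hVT a, measure_cylinder_eq_sum]
    refine Finset.sum_congr rfl fun a _ => ?_
    have hindVT : IndepFun (V ⟨k + 1, append u a⟩) (tailMass V μ l (append u a)) P :=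
      indepFun_of_measurable_sigmaOn hV hind (disjoint_length_le_properExtensions (append u a))
        (measurable_sigmaOn (le_refl (k + 1))) (measurable_tailMass V μ l _)
    rw [lintegral_mul_eq_lintegral_mul_lintegral_of_indepFun'' (hV _).aemeasurable
      (hT a).aemeasurable hindVT, hmean, one_mul, ih]

lemma lintegral_mul_rpow_of_indepFun {q : ℝ} (hq : 0 ≤ q) {f g : Ω → ℝ≥0∞} (hf : Measurable f)
    (hg : Measurable g) (hfg : IndepFun f g P) :
    ∫⁻ ω, (f ω * g ω) ^ q ∂P = (∫⁻ ω, f ω ^ q ∂P) * ∫⁻ ω, g ω ^ q ∂P := by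
  have hfg' : IndepFun (fun ω => f ω ^ q) (fun ω => g ω ^ q) P :=
    hfg.comp (φ := fun x : ℝ≥0∞ => x ^ q) (ψ := fun x : ℝ≥0∞ => x ^ q) (by fun_prop) (by fun_prop)
  simp_rw [ENNReal.mul_rpow_of_nonneg _ _ hq]
  exact lintegral_mul_eq_lintegral_mul_lintegral_of_indepFun'' (by fun_prop) (by fun_prop) hfg'

lemma lintegral_pathProd_mul_rpow (hV : ∀ w, Measurable (V w)) (hind : iIndepFun V P) {q : ℝ}
    (hq : 0 ≤ q) (u : Fin k → Fin m) {f : Ω → ℝ≥0∞}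
    (hf : Measurable[sigmaOn V (properExtensions u)] f) :
    ∫⁻ ω, (pathProd (fun w => V w ω) u * f ω) ^ q ∂P =
      (∫⁻ ω, pathProd (fun w => V w ω) u ^ q ∂P) * ∫⁻ ω, f ω ^ q ∂P :=
  lintegral_mul_rpow_of_indepFun hq ((measurable_pathProd V u).mono (sigmaOn_le hV _) le_rfl)
    (hf.mono (sigmaOn_le hV _) le_rfl) (indepFun_of_measurable_sigmaOn hV hind
      (disjoint_length_le_properExtensions u) (measurable_pathProd V u) hf)

lemma lintegral_pathProd_append_mul_tailMass_rpow (hV : ∀ w, Measurable (V w))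
    (hind : iIndepFun V P) (μ : Measure (ℕ → Fin m)) (l : ℕ) {q : ℝ} (hq : 0 ≤ q)
    (u : Fin k → Fin m) (a : Fin m) :
    ∫⁻ ω, (pathProd (fun w => V w ω) (append u a) * tailMass V μ l (append u a) ω) ^ q ∂P =
      (∫⁻ ω, pathProd (fun w => V w ω) u ^ q ∂P) *
        ∫⁻ ω, (V ⟨k + 1, append u a⟩ ω * tailMass V μ l (append u a) ω) ^ q ∂P := by
  rw [← lintegral_pathProd_mul_rpow hV hind hq u ((measurable_mul_tailMass V μ l _).mono
    (sigmaOn_mono (extensions_append_subset u a)) le_rfl)]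
  simp_rw [pathProd_append, mul_assoc]

lemma indepFun_mul_tailMass_sum (hV : ∀ w, Measurable (V w)) (hind : iIndepFun V P)
    (μ : Measure (ℕ → Fin m)) (l : ℕ) (u : Fin k → Fin m) (a : Fin m) :
    IndepFun (fun ω => V ⟨k + 1, append u a⟩ ω * tailMass V μ l (append u a) ω)
      (fun ω => ∑ b ∈ {a}ᶜ, V ⟨k + 1, append u b⟩ ω * tailMass V μ l (append u b) ω) P := by
  have hdisj : Disjoint (extensions (append u a))
      (⋃ b ∈ ({a}ᶜ : Finset (Fin m)), extensions (append u b)) :=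
    Set.disjoint_iUnion₂_right.2 fun b hb => disjoint_extensions fun h =>
      Finset.notMem_singleton.1 (Finset.mem_compl.1 hb) (append_injective u h).symm
  refine indepFun_of_measurable_sigmaOn hV hind hdisj (measurable_mul_tailMass V μ l _)
    (Finset.measurable_sum _ fun b hb => ?_)
  exact (measurable_mul_tailMass V μ l _).mono
    (sigmaOn_mono (Set.subset_biUnion_of_mem (u := fun b => extensions (append u b)) hb)) le_rfl

/-- The moment sum `∑_{|u| = k} E((V_{u₁} ⋯ V_{u₁ ⋯ u_k} T_u) ^ q)`, where `T_u` is the mass of the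
cylinder of `u` after `l` further levels. It interpolates between the sum of the hypothesis of the
theorem (`l = 0`) and the moment of the total mass of level `l` (`k = 0`). -/
noncomputable def momentSum (V : Word m → Ω → ℝ≥0∞) (P : Measure Ω) (μ : Measure (ℕ → Fin m))
    (q : ℝ) (k l : ℕ) : ℝ≥0∞ :=
  ∑ u : Fin k → Fin m, ∫⁻ ω, (pathProd (fun w => V w ω) u * tailMass V μ l u ω) ^ q ∂P

lemma lintegral_levelMass_rpow_le (hV : ∀ w, Measurable (V w)) (μ : Measure (ℕ → Fin m)) {q : ℝ}
    (hq : 1 ≤ q) (k l : ℕ) :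
    ∫⁻ ω, levelMass V μ (k + l) ω ^ q ∂P ≤
      (Fintype.card (Fin k → Fin m) : ℝ≥0∞) ^ (q - 1) * momentSum V P μ q k l := by
  simp_rw [← sum_pathProd_mul_tailMass]
  exact lintegral_sum_rpow_le P hq fun u =>
    ((measurable_pathProd V u).mono (sigmaOn_le hV _) le_rfl).mul
      ((measurable_tailMass V μ l u).mono (sigmaOn_le hV _) le_rfl)

variable [IsProbabilityMeasure P]

lemma exists_momentSum_succ_le (hV : ∀ w, Measurable (V w)) (hind : iIndepFun V P)
    (hmean : ∀ w, ∫⁻ ω, V w ω ∂P = 1) (μ : Measure (ℕ → Fin m)) {q : ℝ} (hq : 1 < q) {D : ℝ≥0}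
    (hD : 1 < D) :
    ∃ C : ℝ≥0, ∀ k l, momentSum V P μ q k (l + 1) ≤
      D * momentSum V P μ q (k + 1) l + C * momentSum V P μ q k 0 := by
  have hq0 : 0 ≤ q := by linarith
  obtain ⟨C, hC⟩ := exists_lintegral_sum_rpow_le P (ι := Fin m) hq hD
  refine ⟨C, fun k l => ?_⟩
  simp_rw [momentSum, sum_append, Finset.mul_sum, ← Finset.sum_add_distrib]
  refine Finset.sum_le_sum fun u _ => ?_
  set I := ∫⁻ ω, pathProd (fun w => V w ω) u ^ q ∂P with hI
  have hfactor_zero : ∫⁻ ω, (pathProd (fun w => V w ω) u * tailMass V μ 0 u ω) ^ q ∂P =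
      I * μ (cylinder u) ^ q := by
    rw [lintegral_pathProd_mul_rpow hV hind hq0 u (measurable_tailMass V μ 0 u)]
    simp only [tailMass, lintegral_const, measure_univ, mul_one, I]
  simp_rw [lintegral_pathProd_append_mul_tailMass_rpow hV hind μ l hq0, ← hI, hfactor_zero]
  calc ∫⁻ ω, (pathProd (fun w => V w ω) u * tailMass V μ (l + 1) u ω) ^ q ∂P
      = I * ∫⁻ ω, tailMass V μ (l + 1) u ω ^ q ∂P :=
        lintegral_pathProd_mul_rpow hV hind hq0 u (measurable_tailMass V μ _ u)
    _ ≤ I * (D * ∑ a, ∫⁻ ω, (V ⟨k + 1, append u a⟩ ω * tailMass V μ l (append u a) ω) ^ q ∂P +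
          C * (∫⁻ ω, tailMass V μ (l + 1) u ω ∂P) ^ q) := by
        gcongr
        exact hC _ (fun a => (measurable_mul_tailMass V μ l _).mono (sigmaOn_le hV _) le_rfl)
          (indepFun_mul_tailMass_sum hV hind μ l u)
    _ = ∑ a, D * (I * ∫⁻ ω, (V ⟨k + 1, append u a⟩ ω * tailMass V μ l (append u a) ω) ^ q ∂P) +
          C * (I * μ (cylinder u) ^ q) := by
        rw [lintegral_tailMass hV hind hmean, ← Finset.mul_sum, ← Finset.mul_sum]
        ring

lemma exists_momentSum_le_tsum (hV : ∀ w, Measurable (V w)) (hind : iIndepFun V P)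
    (hmean : ∀ w, ∫⁻ ω, V w ω ∂P = 1) (μ : Measure (ℕ → Fin m)) {q : ℝ} (hq : 1 < q) {D : ℝ≥0}
    (hD : 1 < D) :
    ∃ C : ℝ≥0, ∀ k l, momentSum V P μ q k l ≤
      C * ∑' i, (D : ℝ≥0∞) ^ i * momentSum V P μ q (k + i) 0 := by
  obtain ⟨C, hC⟩ := exists_momentSum_succ_le hV hind hmean μ hq hD
  have hsplit : ∀ k, ∑' i, (D : ℝ≥0∞) ^ i * momentSum V P μ q (k + i) 0 =
      momentSum V P μ q k 0 +
        D * ∑' i, (D : ℝ≥0∞) ^ i * momentSum V P μ q (k + 1 + i) 0 := fun k => by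
    rw [tsum_eq_zero_add' ENNReal.summable, ← ENNReal.tsum_mul_left]
    simp_rw [pow_succ', mul_assoc, pow_zero, one_mul, add_zero, add_assoc, add_comm 1]
  refine ⟨max C 1, fun k l => ?_⟩
  induction l generalizing k with
  | zero =>
    calc momentSum V P μ q k 0
        ≤ 1 * ∑' i, (D : ℝ≥0∞) ^ i * momentSum V P μ q (k + i) 0 := by
          rw [one_mul, hsplit]
          exact le_self_add
      _ ≤ _ := by
          gcongr
          exact_mod_cast le_max_right C 1
  | succ l ih =>
    calc momentSum V P μ q k (l + 1)
        ≤ D * momentSum V P μ q (k + 1) l + C * momentSum V P μ q k 0 := hC k l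
      _ ≤ D * ((max C 1 : ℝ≥0) * ∑' i, (D : ℝ≥0∞) ^ i * momentSum V P μ q (k + 1 + i) 0) +
            (max C 1 : ℝ≥0) * momentSum V P μ q k 0 := by
          gcongr
          · exact ih (k + 1)
          · exact le_max_left C 1
      _ = _ := by
          rw [hsplit k]
          ring

lemma exists_lintegral_levelMass_rpow_le (hV : ∀ w, Measurable (V w)) (hind : iIndepFun V P)
    (hmean : ∀ w, ∫⁻ ω, V w ω ∂P = 1) (μ : Measure (ℕ → Fin m)) {q : ℝ} (hq : 1 < q)
    (hcond : limsup (fun k : ℕ => momentSum V P μ q k 0 ^ (1 / (k : ℝ))) atTop < 1) :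
    ∃ K, ∃ R ≠ ∞, ∀ l, ∫⁻ ω, levelMass V μ (K + l) ω ^ q ∂P ≤ R := by
  obtain ⟨D, hD, K, hsum⟩ := exists_tsum_pow_mul_ne_top_of_limsup_lt hcond
  obtain ⟨C, hC⟩ := exists_momentSum_le_tsum hV hind hmean μ hq hD
  refine ⟨K, (Fintype.card (Fin K → Fin m) : ℝ≥0∞) ^ (q - 1) *
    (C * ∑' i, (D : ℝ≥0∞) ^ i * momentSum V P μ q (K + i) 0), ENNReal.mul_ne_top
    (ENNReal.rpow_ne_top_of_nonneg (by linarith) (ENNReal.natCast_ne_top _))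
    (ENNReal.mul_ne_top ENNReal.coe_ne_top hsum), fun l => ?_⟩
  exact (lintegral_levelMass_rpow_le hV μ hq.le K l).trans (by gcongr; exact hC K l)

end MomentBound

section Martingale

variable {m k : ℕ} {Ω : Type*}

lemma totalMass_eq_cylinderSum (W : Word m → Ω → ℝ) (μ : Measure (ℕ → Fin m))
    [IsFiniteMeasure μ] (k : ℕ) : totalMass W μ k = cylinderSum W μ k :=
  funext fun ω => (integral_curtail μ fun u => X W u ω).trans
    (Finset.sum_congr rfl fun _ _ => mul_comm _ _)

lemma totalMass_eq_sum_smul (W : Word m → Ω → ℝ) (μ : Measure (ℕ → Fin m)) [IsFiniteMeasure μ]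
    (k : ℕ) : totalMass W μ k = ∑ u : Fin k → Fin m, μ.real (cylinder u) • X W u := by
  ext ω
  rw [totalMass, integral_curtail μ fun u => X W u ω, Finset.sum_apply]
  rfl

lemma X_append (W : Word m → Ω → ℝ) (u : Fin k → Fin m) (a : Fin m) :
    X W (append u a) = X W u * W ⟨k + 1, append u a⟩ :=
  funext fun ω => pathProd_append (fun w => W w ω) u a

variable [MeasurableSpace Ω] {P : Measure Ω} {W : Word m → Ω → ℝ}

lemma measurable_X_filtration (hW : ∀ w, Measurable (W w)) (u : Fin k → Fin m) :
    Measurable[filtration W hW k] (X W u) :=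
  measurable_pathProd W u

lemma indep_filtration (hW : ∀ w, Measurable (W w)) (hind : iIndepFun W P)
    (v : Fin (k + 1) → Fin m) : Indep (filtration W hW k) (sigmaOn W {⟨k + 1, v⟩}) P :=
  indep_sigmaOn hW hind (Set.disjoint_singleton_right.2 k.lt_succ_self.not_ge)

variable [IsProbabilityMeasure P]

lemma integrable_X (hW : ∀ w, Measurable (W w)) (hind : iIndepFun W P)
    (hint : ∀ w, Integrable (W w) P) (u : Fin k → Fin m) : Integrable (X W u) P := by
  induction k with
  | zero =>
    rw [show X W u = fun _ => 1 from funext fun ω => Fin.prod_univ_zero _]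
    exact integrable_const 1
  | succ k ih =>
    obtain ⟨v, a, rfl⟩ := exists_eq_append u
    have hXW : IndepFun (X W v) (W ⟨k + 1, append v a⟩) P :=
      indep_of_indep_of_le_right (indep_of_indep_of_le_left (indep_filtration hW hind _)
        (measurable_X_filtration hW v).comap_le)
        (measurable_sigmaOn (V := W) (Set.mem_singleton _)).comap_le
    rw [X_append]
    exact hXW.integrable_mul (ih v) (hint _)

lemma condExp_X_append (hW : ∀ w, Measurable (W w)) (hind : iIndepFun W P)
    (hmean : ∀ w, ∫ ω, W w ω ∂P = 1) (u : Fin k → Fin m) (a : Fin m) :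
    P[X W (append u a) | filtration W hW k] =ᵐ[P] X W u := by
  have hint : ∀ w, Integrable (W w) P := fun w => integrable_of_integral_eq_one (hmean w)
  have hXW := integrable_X hW hind hint (append u a)
  rw [X_append] at hXW ⊢
  have hpull := condExp_mul_of_stronglyMeasurable_left
    (measurable_X_filtration hW u).stronglyMeasurable hXW (hint ⟨k + 1, append u a⟩)
  have hconst := condExp_indep_eq (sigmaOn_le hW _) ((filtration W hW).le k)
    (measurable_sigmaOn (Set.mem_singleton _)).stronglyMeasurable
    (indep_filtration hW hind (append u a)).symm
  filter_upwards [hpull, hconst] with ω hpull hconst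
  rw [hpull, Pi.mul_apply, hconst, hmean, mul_one]

lemma condExp_sum_smul_X_append (hW : ∀ w, Measurable (W w)) (hind : iIndepFun W P)
    (hmean : ∀ w, ∫ ω, W w ω ∂P = 1) (u : Fin k → Fin m) (c : Fin m → ℝ) :
    P[∑ a, c a • X W (append u a) | filtration W hW k] =ᵐ[P] (∑ a, c a) • X W u := by
  have hX : ∀ a, P[c a • X W (append u a) | filtration W hW k] =ᵐ[P] c a • X W u := fun a =>
    (condExp_smul _ _ _).trans ((condExp_X_append hW hind hmean u a).const_smul _)
  have hint : ∀ a ∈ Finset.univ, Integrable (c a • X W (append u a)) P := fun a _ =>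
    (integrable_X hW hind (fun w => integrable_of_integral_eq_one (hmean w)) _).smul _
  filter_upwards [condExp_finsetSum hint (filtration W hW k), ae_all_iff.2 hX] with ω hsum hX
  rw [hsum, Finset.sum_apply, Finset.sum_smul, Finset.sum_apply]
  exact Finset.sum_congr rfl fun a _ => hX a

lemma martingale_totalMass (hW : ∀ w, Measurable (W w)) (hind : iIndepFun W P)
    (hmean : ∀ w, ∫ ω, W w ω ∂P = 1) (μ : Measure (ℕ → Fin m)) [IsFiniteMeasure μ] :
    Martingale (totalMass W μ) (filtration W hW) P := by
  have hint : ∀ {k} (c : ℝ) (u : Fin k → Fin m), Integrable (c • X W u) P := fun c u =>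
    (integrable_X hW hind (fun w => integrable_of_integral_eq_one (hmean w)) u).smul c
  refine martingale_nat (fun k => ?_) (fun k => ?_) fun k => ?_
  · rw [totalMass_eq_sum_smul]
    exact Finset.stronglyMeasurable_sum _ fun u _ =>
      (measurable_X_filtration hW u).stronglyMeasurable.const_smul _
  · rw [totalMass_eq_sum_smul]
    exact integrable_finsetSum' _ fun u _ => hint _ u
  · have hsum := condExp_finsetSum (s := Finset.univ) (μ := P)
      (f := fun u : Fin k → Fin m => ∑ a, μ.real (cylinder (append u a)) • X W (append u a))
      (fun u _ => integrable_finsetSum' _ fun a _ => hint _ _) (filtration W hW k)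
    rw [totalMass_eq_sum_smul W μ (k + 1), sum_append]
    filter_upwards [hsum, ae_all_iff.2 fun u : Fin k → Fin m => condExp_sum_smul_X_append hW hind
      hmean u fun a => μ.real (cylinder (append u a))] with ω hsum hX
    rw [hsum, totalMass_eq_sum_smul, Finset.sum_apply, Finset.sum_apply]
    refine Finset.sum_congr rfl fun u _ => ?_
    rw [hX, measureReal_cylinder_eq_sum]

end Martingale

section Moments

variable {m k : ℕ} {Ω : Type*} {W : Word m → Ω → ℝ} {ω : Ω}

lemma X_nonneg (hω : ∀ w, 0 ≤ W w ω) (u : Fin k → Fin m) : 0 ≤ X W u ω :=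
  Finset.prod_nonneg fun _ _ => hω _

lemma ofReal_X_mul_measureReal (hω : ∀ w, 0 ≤ W w ω) (μ : Measure (ℕ → Fin m))
    [IsFiniteMeasure μ] (u : Fin k → Fin m) :
    ENNReal.ofReal (X W u ω * μ.real (cylinder u)) =
      pathProd (fun w => ENNReal.ofReal (W w ω)) u * μ (cylinder u) := by
  rw [ENNReal.ofReal_mul (X_nonneg hω u), ofReal_measureReal, X,
    ENNReal.ofReal_prod_of_nonneg fun _ _ => hω _, pathProd]

lemma cylinderSum_nonneg (hω : ∀ w, 0 ≤ W w ω) (μ : Measure (ℕ → Fin m)) (k : ℕ) :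
    0 ≤ cylinderSum W μ k ω :=
  Finset.sum_nonneg fun u _ => mul_nonneg (X_nonneg hω u) measureReal_nonneg

lemma ofReal_cylinderSum (hω : ∀ w, 0 ≤ W w ω) (μ : Measure (ℕ → Fin m)) [IsFiniteMeasure μ]
    (k : ℕ) : ENNReal.ofReal (cylinderSum W μ k ω) =
      levelMass (fun w ω => ENNReal.ofReal (W w ω)) μ k ω := by
  rw [cylinderSum, ENNReal.ofReal_sum_of_nonneg fun u _ =>
    mul_nonneg (X_nonneg hω u) measureReal_nonneg]
  exact Finset.sum_congr rfl fun u _ => ofReal_X_mul_measureReal hω μ u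

variable [MeasurableSpace Ω] {P : Measure Ω} {q : ℝ}

lemma moment_eq_lintegral_ofReal_rpow {Z : Ω → ℝ} (hZ : ∀ᵐ ω ∂P, 0 ≤ Z ω) (hq : 0 ≤ q) :
    moment P q Z = ∫⁻ ω, ENNReal.ofReal (Z ω) ^ q ∂P :=
  lintegral_congr_ae (hZ.mono fun _ h => (ENNReal.ofReal_rpow_of_nonneg h hq).symm)

lemma moment_eq_eLpNorm_rpow {Z : Ω → ℝ} (hZ : ∀ᵐ ω ∂P, 0 ≤ Z ω) (hq : 0 < q) :
    moment P q Z = eLpNorm Z (ENNReal.ofReal q) P ^ q := by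
  rw [eLpNorm_eq_lintegral_rpow_enorm_toReal (by simpa using hq) ENNReal.ofReal_ne_top,
    ENNReal.toReal_ofReal hq.le, one_div, ENNReal.rpow_inv_rpow hq.ne',
    moment_eq_lintegral_ofReal_rpow hZ hq.le]
  exact lintegral_congr_ae (hZ.mono fun ω h => by simp only [Real.enorm_of_nonneg h])

lemma sum_moment_eq_momentSum (hnonneg : ∀ w, ∀ᵐ ω ∂P, 0 ≤ W w ω) (μ : Measure (ℕ → Fin m))
    [IsFiniteMeasure μ] (hq : 0 ≤ q) (k : ℕ) :
    ∑ u : Fin k → Fin m, moment P q (fun ω => X W u ω * μ.real (cylinder u)) =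
      momentSum (fun w ω => ENNReal.ofReal (W w ω)) P μ q k 0 := by
  refine Finset.sum_congr rfl fun u _ => ?_
  have hnonneg' := ae_all_iff.2 hnonneg
  rw [moment_eq_lintegral_ofReal_rpow
    (hnonneg'.mono fun ω hω => mul_nonneg (X_nonneg hω u) measureReal_nonneg) hq]
  exact lintegral_congr_ae (hnonneg'.mono fun ω hω => by
    simp only [ofReal_X_mul_measureReal hω, tailMass])

variable [IsProbabilityMeasure P]

lemma exists_moment_cylinderSum_le (hW : ∀ w, Measurable (W w)) (hind : iIndepFun W P)
    (hnonneg : ∀ w, ∀ᵐ ω ∂P, 0 ≤ W w ω) (hmean : ∀ w, ∫ ω, W w ω ∂P = 1)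
    (μ : Measure (ℕ → Fin m)) [IsFiniteMeasure μ] (hq : 1 < q)
    (hcond : limsup (fun k : ℕ =>
      (∑ u : Fin k → Fin m, moment P q (fun ω => X W u ω * μ.real (cylinder u)))
        ^ (1 / (k : ℝ))) atTop < 1) :
    ∃ K, ∃ R ≠ ∞, ∀ l, moment P q (cylinderSum W μ (K + l)) ≤ R := by
  have hq0 : 0 ≤ q := by linarith
  have hnonneg' := ae_all_iff.2 hnonneg
  simp_rw [sum_moment_eq_momentSum hnonneg μ hq0] at hcond
  have hindV : iIndepFun (fun w ω => ENNReal.ofReal (W w ω)) P :=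
    hind.comp (fun _ => ENNReal.ofReal) fun _ => ENNReal.measurable_ofReal
  have hmeanV : ∀ w, ∫⁻ ω, ENNReal.ofReal (W w ω) ∂P = 1 := fun w => by
    rw [← ofReal_integral_eq_lintegral_ofReal (integrable_of_integral_eq_one (hmean w))
      (hnonneg w), hmean, ENNReal.ofReal_one]
  obtain ⟨K, R, hR, hle⟩ := exists_lintegral_levelMass_rpow_le
    (fun w => (hW w).ennreal_ofReal) hindV hmeanV μ hq hcond
  refine ⟨K, R, hR, fun l => le_trans (le_of_eq ?_) (hle l)⟩
  rw [moment_eq_lintegral_ofReal_rpow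
    (hnonneg'.mono fun ω hω => cylinderSum_nonneg hω μ (K + l)) hq0]
  exact lintegral_congr_ae (hnonneg'.mono fun ω hω => by
    simp only [ofReal_cylinderSum hω])

lemma exists_eLpNorm_totalMass_le (hW : ∀ w, Measurable (W w)) (hind : iIndepFun W P)
    (hnonneg : ∀ w, ∀ᵐ ω ∂P, 0 ≤ W w ω) (hmean : ∀ w, ∫ ω, W w ω ∂P = 1)
    (μ : Measure (ℕ → Fin m)) [IsFiniteMeasure μ] (hq : 1 < q)
    (hcond : limsup (fun k : ℕ =>
      (∑ u : Fin k → Fin m, moment P q (fun ω => X W u ω * μ.real (cylinder u)))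
        ^ (1 / (k : ℝ))) atTop < 1) :
    ∃ R : ℝ≥0, ∀ k, eLpNorm (totalMass W μ k) (ENNReal.ofReal q) P ≤ R := by
  have hq0 : 0 < q := by linarith
  obtain ⟨K, R, hR, hle⟩ := exists_moment_cylinderSum_le hW hind hnonneg hmean μ hq hcond
  lift R to ℝ≥0 using hR
  have hmono : Monotone fun k => eLpNorm (totalMass W μ k) (ENNReal.ofReal q) P :=
    monotone_eLpNorm_of_martingale (by simpa using hq.le) (martingale_totalMass hW hind hmean μ)
  refine ⟨R ^ q⁻¹, fun k => (hmono (k.le_add_left K)).trans ?_⟩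
  dsimp only
  rw [ENNReal.coe_rpow_of_nonneg _ (by positivity), ENNReal.le_rpow_inv_iff hq0,
    totalMass_eq_cylinderSum, ← moment_eq_eLpNorm_rpow ((ae_all_iff.2 hnonneg).mono
      fun ω hω => cylinderSum_nonneg hω μ (K + k)) hq0]
  exact hle k

end Moments

end Cascade

theorem theorem1p1_general {Ω : Type*} [MeasurableSpace Ω] (P : Measure Ω)
    [IsProbabilityMeasure P] (m : ℕ) (W : Cascade.Word m → Ω → ℝ)
    (hW_meas : ∀ i, Measurable (W i))
    (hW_indep : iIndepFun W P)
    (hW_nonneg : ∀ i, ∀ᵐ ω ∂P, 0 ≤ W i ω)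
    (hW_mean : ∀ i, ∫ ω, W i ω ∂P = 1)
    (μ : Measure (ℕ → Fin m)) [IsFiniteMeasure μ]
    (q : ℝ) (hq : 1 < q)
    (hcond : limsup (fun k : ℕ =>
      (∑ i : Fin k → Fin m,
        Cascade.moment P q (fun ω => Cascade.X W i ω * μ.real (Cascade.cylinder i)))
          ^ (1 / (k : ℝ))) atTop < 1) :
    (∀ k ω, Cascade.totalMass W μ k ω = Cascade.cylinderSum W μ k ω) ∧
    Martingale (Cascade.totalMass W μ) (Cascade.filtration W hW_meas) P ∧
    limsup (fun k : ℕ => Cascade.moment P q (Cascade.totalMass W μ k)) atTop =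
      limsup (fun k : ℕ => Cascade.moment P q (Cascade.cylinderSum W μ k)) atTop ∧
    limsup (fun k : ℕ => Cascade.moment P q (Cascade.cylinderSum W μ k)) atTop < ⊤ ∧
    (⨆ k : ℕ, Cascade.moment P q (Cascade.totalMass W μ k)) < ⊤ ∧
    ∃ Z : Ω → ℝ, MemLp Z (ENNReal.ofReal q) P ∧
      (∀ᵐ ω ∂P, Tendsto (fun k : ℕ => Cascade.totalMass W μ k ω) atTop (𝓝 (Z ω))) ∧
      Tendsto (fun k : ℕ =>
        eLpNorm (fun ω => Cascade.totalMass W μ k ω - Z ω) (ENNReal.ofReal q) P) atTop (𝓝 0) := by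
  have hq0 : 0 < q := by linarith
  have heq := Cascade.totalMass_eq_cylinderSum W μ
  have hmart := Cascade.martingale_totalMass hW_meas hW_indep hW_mean μ
  obtain ⟨R, hR⟩ :=
    Cascade.exists_eLpNorm_totalMass_le hW_meas hW_indep hW_nonneg hW_mean μ hq hcond
  have hmoment : ∀ k, Cascade.moment P q (Cascade.totalMass W μ k) ≤ (R : ℝ≥0∞) ^ q := fun k => by
    rw [Cascade.moment_eq_eLpNorm_rpow (heq k ▸ (ae_all_iff.2 hW_nonneg).mono
      fun ω hω => Cascade.cylinderSum_nonneg hω μ k) hq0]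
    gcongr
    exact hR k
  have hfin : (R : ℝ≥0∞) ^ q < ⊤ := ENNReal.rpow_lt_top_of_nonneg hq0.le ENNReal.coe_ne_top
  have hlimsup : limsup (fun k => Cascade.moment P q (Cascade.totalMass W μ k)) atTop < ⊤ :=
    (limsup_le_of_le (h := Eventually.of_forall hmoment)).trans_lt hfin
  refine ⟨fun k => congrFun (heq k), hmart, by simp_rw [heq], by simpa only [heq] using hlimsup,
    (iSup_le hmoment).trans_lt hfin, ?_⟩
  exact exists_tendsto_Lp_of_martingale (by simpa using hq) ENNReal.ofReal_ne_top hmart hR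

theorem theorem1p1 {Ω : Type*} [MeasurableSpace Ω] (P : Measure Ω) [IsProbabilityMeasure P]
    (m : ℕ) (W : Cascade.Word m → Ω → ℝ)
    (hW_meas : ∀ i, Measurable (W i))
    (hW_indep : iIndepFun W P)
    (hW_pos : ∀ i, ∀ᵐ ω ∂P, 0 < W i ω)
    (hW_int : ∀ i, Integrable (W i) P)
    (hW_mean : ∀ i, ∫ ω, W i ω ∂P = 1)
    (μ : Measure (ℕ → Fin m)) [IsProbabilityMeasure μ]
    (q : ℝ) (hq : 1 < q)
    (hcond : limsup (fun k : ℕ =>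
      (∑ i : Fin k → Fin m,
        Cascade.moment P q (fun ω => Cascade.X W i ω * μ.real (Cascade.cylinder i)))
          ^ (1 / (k : ℝ))) atTop < 1) :
    (∀ k ω, Cascade.totalMass W μ k ω = Cascade.cylinderSum W μ k ω) ∧
    Martingale (Cascade.totalMass W μ) (Cascade.filtration W hW_meas) P ∧
    limsup (fun k : ℕ => Cascade.moment P q (Cascade.totalMass W μ k)) atTop =
      limsup (fun k : ℕ => Cascade.moment P q (Cascade.cylinderSum W μ k)) atTop ∧
    limsup (fun k : ℕ => Cascade.moment P q (Cascade.cylinderSum W μ k)) atTop < ⊤ ∧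
    (⨆ k : ℕ, Cascade.moment P q (Cascade.totalMass W μ k)) < ⊤ ∧
    ∃ Z : Ω → ℝ, MemLp Z (ENNReal.ofReal q) P ∧
      (∀ᵐ ω ∂P, Tendsto (fun k : ℕ => Cascade.totalMass W μ k ω) atTop (𝓝 (Z ω))) ∧
      Tendsto (fun k : ℕ =>
        eLpNorm (fun ω => Cascade.totalMass W μ k ω - Z ω) (ENNReal.ofReal q) P) atTop (𝓝 0) := by
  exact theorem1p1_general P m W hW_meas hW_indep (fun i => (hW_pos i).mono fun _ => le_of_lt)
    hW_mean μ q hq hcond
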